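/- Let $N=\{1,\dots,n\}$ with $n\ge 2$ be a set of voters partitioned into groups $N_1,\dots,N_g$, and let $P=\{p_1,\dots,p_m\}$, $m\ge 1$, be a set of projects ordered by $p_1\triangleleft\cdots\triangleleft p_m$; minima, maxima and intervals are taken with respect to this order. Let $\mathcal D$ be the set of all strict linear orders $\succ$ on $P$ that are single-peaked, i.e. for the top-ranked project $\mathrm{top}(\succ)$ one has $p\succ p'$ whenever $\mathrm{top}(\succ)\triangleleft p\triangleleft p'$ or $p'\triangleleft p\triangleleft \mathrm{top}(\succ)$. A deterministic rule is a map $f:\mathcal D^n\to P$; a random rule is a map $\varphi:\mathcal D^n\to\Delta P$ into the probability distributions on $P$, and $\varphi_p(\mathcal P)$ is the probability of $p$ at the profile $\mathcal P=(\succ_1,\dots,\succ_n)$. A random rule $\varphi$ is *unanimous* if $\varphi_p(\mathcal P)=1$ whenever all voters rank $p$ on top; *strategy-proof* if for every voter $i$, every profile $\mathcal P$, every $\succ_i'\in\mathcal D$ and every $p\in P$, the set of projects that are at least as good as $p$ for $\succ_i$ has at $\mathcal P$ at least the probability that it has after $\succ_i$ is replaced by $\succ_i'$; and *group-wise anonymous*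 if $\varphi(\succ_{\pi(1)},\dots,\succ_{\pi(n)})=\varphi(\succ_1,\dots,\succ_n)$ for every profile and every permutation $\pi$ of $N$ that maps each group to itself. Let $\Gamma=\prod_{q=1}^g\{0,\dots,|N_q|\}$, ordered componentwise, with least element $\underline\gamma=(0,\dots,0)$ and greatest element $\overline\gamma=(|N_1|,\dots,|N_g|)$. For $0\le t\le m$ let $\alpha(t;\mathcal P)\in\Gamma$ be the vector whose $q$-th entry is the number of voters in $N_q$ whose top-ranked project is in $\{p_1,\dots,p_t\}$. For $1\le t\le|N_q|$ let $\tau_t(\mathcal P_{N_q})$ be the $t$-th project when the top-ranked projects of the voters in $N_q$ are listed in increasing order with repetition, and let $\tau_0(\mathcal P_{N_q})=p_1$. A random rule $\varphi$ is a *probabilistic fixed group ballot rule* if there are distributions $\delta_\gamma\in\Delta P$ ($\gamma\in\Gamma$) with $\delta_{\underline\gamma}(p_m)=1$, $\delta_{\overline\gamma}(p_1)=1$, and $\delta_\gamma([p_1,p_t])\ge\delta_{\gamma'}([p_1,p_t])$ for all $\gamma\ge\gamma'$ and $1\le t\le m$, such that for all $\mathcal P\in\mathcal D^n$ and $1\le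 t\le m$ $$\varphi_{p_t}(\mathcal P)=\delta_{\alpha(t;\mathcal P)}([p_1,p_t])-\delta_{\alpha(t-1;\mathcal P)}([p_1,p_{t-1}]),$$ where the subtracted term is $0$ for $t=1$. A deterministic rule $f$ is a *group min-max rule* if there are projects $\beta_\gamma\in P$ ($\gamma\in\Gamma$) with $\beta_{\underline\gamma}=p_m$, $\beta_{\overline\gamma}=p_1$, and $\beta_\gamma\trianglelefteq\beta_{\gamma'}$ for all $\gamma\ge\gamma'$, such that for all $\mathcal P\in\mathcal D^n$ $$f(\mathcal P)=\min_{\gamma\in\Gamma}\max\{\tau_{\gamma_1}(\mathcal P_{N_1}),\dots,\tau_{\gamma_g}(\mathcal P_{N_g}),\beta_\gamma\}.$$ A random rule is a *random group min-max rule* if it is a finite convex combination $\sum_w\lambda_w f_w$ of deterministic rules (each viewed as a random rule that puts probability $1$ on its outcome) such that every $f_w$ with $\lambda_w>0$ is a group min-max rule. **Theorem.** (1) Every probabilistic fixed group ballot rule is a random group min-max rule. (2) A random rule is unanimous, strategy-proof and group-wise anonymous if and only if it is a random group min-max rule. -/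

import Mathlib

namespace GroupFair

/-- A strictly ordinal preference on the projects `p_1 ◁ ... ◁ p_m` (modelled by `Fin m` with its
usual order): a complete, reflexive, antisymmetric and transitive relation.
`rel p p'` reads "`p` is at least as good as `p'`". -/
structure Pref (m : ℕ) where
  rel : Fin m → Fin m → Prop
  complete : ∀ p p', rel p p' ∨ rel p' p
  refl : ∀ p, rel p p
  antisymm : ∀ p p', rel p p' → rel p' p → p = p'
  trans : ∀ p p' p'', rel p p' → rel p' p'' → rel p p''

/-- `p` is strictly preferred over `p'`. -/
def Pref.Strict {m : ℕ} (r : Pref m) (p p' : Fin m) : Prop := r.rel p p' ∧ p ≠ p'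

theorem Pref.exists_top {m : ℕ} [NeZero m] (r : Pref m) : ∃ p, ∀ p', r.rel p p' := by
  have key : ∀ s : Finset (Fin m), s.Nonempty → ∃ p ∈ s, ∀ p' ∈ s, r.rel p p' := by
    intro s hs
    induction hs using Finset.Nonempty.cons_induction with
    | singleton a => exact ⟨a, by simp, by simpa using r.refl a⟩
    | cons a s ha hs ih =>
      obtain ⟨b, hb, hbs⟩ := ih
      rcases r.complete a b with h | h
      · refine ⟨a, by simp, fun p' hp' => ?_⟩
        rcases Finset.mem_cons.1 hp' with rfl | hp'
        · exact r.refl _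
        · exact r.trans _ _ _ h (hbs _ hp')
      · refine ⟨b, Finset.mem_cons_of_mem hb, fun p' hp' => ?_⟩
        rcases Finset.mem_cons.1 hp' with rfl | hp'
        · exact h
        · exact hbs _ hp'
  obtain ⟨p, -, hp⟩ := key Finset.univ Finset.univ_nonempty
  exact ⟨p, fun p' => hp p' (Finset.mem_univ _)⟩

/-- The top-ranked project of a preference. -/
noncomputable def Pref.peak {m : ℕ} [NeZero m] (r : Pref m) : Fin m := r.exists_top.choose

theorem Pref.rel_peak {m : ℕ} [NeZero m] (r : Pref m) (p : Fin m) : r.rel r.peak p :=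
  r.exists_top.choose_spec p

/-- A project lying between the peak and another project is strictly preferred to the latter. -/
def Pref.IsSinglePeaked {m : ℕ} [NeZero m] (r : Pref m) : Prop :=
  ∀ p p' : Fin m, (r.peak < p ∧ p < p') ∨ (p' < p ∧ p < r.peak) → r.Strict p p'

/-- The set of all single-peaked preferences. -/
abbrev SPDomain (m : ℕ) [NeZero m] : Type := {r : Pref m // r.IsSinglePeaked}

/-- Preference profiles of the `n` voters. -/
abbrev Profile (n m : ℕ) [NeZero m] : Type := Fin n → SPDomain m

/-- Deterministic social choice rules. -/
abbrev DSCR (n m : ℕ) [NeZero m] : Type := Profile n m → Fin m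

/-- Random social choice rules; `stdSimplex ℝ (Fin m)` is the set of probability distributions
over the projects. -/
abbrev RSCR (n m : ℕ) [NeZero m] : Type := Profile n m → stdSimplex ℝ (Fin m)

/-- The upper contour set of `p`. -/
def Pref.upperContour {m : ℕ} (r : Pref m) (p : Fin m) : Set (Fin m) := {p' | r.rel p' p}

/-- The probability `δ(A)` of a set `A` of projects. -/
noncomputable def prob {m : ℕ} (δ : stdSimplex ℝ (Fin m)) (A : Set (Fin m)) : ℝ :=
  ∑ p, A.indicator δ.1 p

/-- `δ` stochastically dominates `δ'` with respect to `r`. -/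
def StochDom {m : ℕ} (r : Pref m) (δ δ' : stdSimplex ℝ (Fin m)) : Prop :=
  ∀ p : Fin m, prob δ' (r.upperContour p) ≤ prob δ (r.upperContour p)

def IsUnanimous {n m : ℕ} [NeZero m] (φ : RSCR n m) : Prop :=
  ∀ (p : Fin m) (P : Profile n m), (∀ i, (P i).1.peak = p) → (φ P).1 p = 1

def IsStrategyProof {n m : ℕ} [NeZero m] (φ : RSCR n m) : Prop :=
  ∀ (i : Fin n) (P : Profile n m) (r' : SPDomain m),
    StochDom (P i).1 (φ P) (φ (Function.update P i r'))

/-! The partition of the voters into `g` groups is given by the map `grp` that sends each voter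
to its group; the group `N_q` is the fibre over `q`. -/

def IsGroupwiseAnonymous {n m g : ℕ} [NeZero m] (grp : Fin n → Fin g) (φ : RSCR n m) : Prop :=
  ∀ π : Equiv.Perm (Fin n), (∀ i, grp (π i) = grp i) →
    ∀ P : Profile n m, φ (fun i => P (π i)) = φ P

/-- The group `N_q`. -/
def group {n g : ℕ} (grp : Fin n → Fin g) (q : Fin g) : Finset (Fin n) :=
  Finset.univ.filter fun i => grp i = q

/-- The set `Γ` of vectors `γ` with `γ_q ∈ {0, ..., |N_q|}`. Domination is the componentwise
order: `γ` dominates `γ'` when `γ' ≤ γ`. -/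
abbrev Gam {n g : ℕ} (grp : Fin n → Fin g) : Type := ∀ q : Fin g, Fin ((group grp q).card + 1)

/-- The vector of all zeros. -/
def gamBot {n g : ℕ} (grp : Fin n → Fin g) : Gam grp := fun _ => 0

/-- The vector `(|N_1|, ..., |N_g|)`. -/
def gamTop {n g : ℕ} (grp : Fin n → Fin g) : Gam grp := fun q => Fin.last (group grp q).card

/-- `α(t; P)`, for `0 ≤ t ≤ m`: the vector counting, in each group, the voters whose peak is among
the first `t` projects `p_1, ..., p_t` (these are the elements of `Fin m` with value `< t`). -/
noncomputable def alpha {n m g : ℕ} [NeZero m] (grp : Fin n → Fin g) (t : ℕ) (P : Profile n m) :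
    Gam grp := fun q =>
  ⟨((group grp q).filter fun i => ((P i).1.peak : ℕ) < t).card,
    Nat.lt_succ_of_le (Finset.card_filter_le _ _)⟩

/-- `δ([p_1, p_t])`, for `0 ≤ t ≤ m`; it is `0` for `t = 0`. -/
noncomputable def cdf {m : ℕ} (δ : stdSimplex ℝ (Fin m)) (t : ℕ) : ℝ :=
  prob δ {p | (p : ℕ) < t}

/-- Probabilistic fixed group ballot rules. The project `p_t` is the element `k = t - 1` of `Fin m`,
so that its probability is the difference of the terms for `t = k + 1` and `t - 1 = k`. -/
def IsPFGBR {n m g : ℕ} [NeZero m] (grp : Fin n → Fin g) (φ : RSCR n m) : Prop :=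
  ∃ δ : Gam grp → stdSimplex ℝ (Fin m),
    ((δ (gamBot grp)).1 ⊤ = 1 ∧ (δ (gamTop grp)).1 ⊥ = 1) ∧
    (∀ γ γ' : Gam grp, γ' ≤ γ → ∀ t : ℕ, 1 ≤ t → t ≤ m → cdf (δ γ') t ≤ cdf (δ γ) t) ∧
    ∀ (P : Profile n m) (k : Fin m),
      (φ P).1 k = cdf (δ (alpha grp (k + 1) P)) (k + 1) - cdf (δ (alpha grp k P)) k

theorem tau_aux {n m g : ℕ} [NeZero m] (grp : Fin n → Fin g) (P : Profile n m) (q : Fin g)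
    (t : Fin ((group grp q).card + 1)) :
    (Finset.univ.filter fun p : Fin m =>
      (t : ℕ) ≤ ((group grp q).filter fun i => (P i).1.peak ≤ p).card).Nonempty := by
  refine ⟨⊤, ?_⟩
  simpa using Nat.le_of_lt_succ t.2

/-- `τ_t(P_{N_q})`: the project at the `t`-th position when the peaks of the voters of group `q` are
arranged in increasing order (with repetition), i.e. the first project `p` such that at least `t`
of these peaks are at or before `p`. For `t = 0` it is `p_1`. -/
noncomputable def tau {n m g : ℕ} [NeZero m] (grp : Fin n → Fin g) (P : Profile n m) (q : Fin g)
    (t : Fin ((group grp q).card + 1)) : Fin m :=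
  (Finset.univ.filter fun p : Fin m =>
    (t : ℕ) ≤ ((group grp q).filter fun i => (P i).1.peak ≤ p).card).min' (tau_aux grp P q t)

/-- Group min-max rules. -/
def IsGMMR {n m g : ℕ} [NeZero m] (grp : Fin n → Fin g) (f : DSCR n m) : Prop :=
  ∃ β : Gam grp → Fin m,
    β (gamBot grp) = ⊤ ∧ β (gamTop grp) = ⊥ ∧ (∀ γ γ' : Gam grp, γ' ≤ γ → β γ ≤ β γ') ∧
    ∀ P : Profile n m,
      f P = Finset.univ.inf' Finset.univ_nonempty fun γ : Gam grp =>
        max (Finset.univ.sup fun q : Fin g => tau grp P q (γ q)) (β γ)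

/-- Random group min-max rules: finite convex combinations `∑ λ_w f_w` of deterministic rules, where
every `f_w` with positive weight is a group min-max rule. -/
def IsRandomGMMR {n m g : ℕ} [NeZero m] (grp : Fin n → Fin g) (φ : RSCR n m) : Prop :=
  ∃ (W : ℕ) (lam : Fin W → ℝ) (f : Fin W → DSCR n m),
    (∀ w, 0 ≤ lam w ∧ lam w ≤ 1) ∧ ∑ w, lam w = 1 ∧ (∀ w, 0 < lam w → IsGMMR grp (f w)) ∧
    ∀ (P : Profile n m) (p : Fin m), (φ P).1 p = ∑ w, lam w * (if f w P = p then 1 else 0)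

end GroupFair

namespace GroupFair

/-! Everything is expressed through thresholds. A min-max rule with ballots `β` picks a project at
or before `p` exactly when the ballot of `α` at that threshold is at or before `p`
(`eq_minmax_iff`). Summing the defining formula of a fixed group ballot rule likewise gives the
probability of `[p_1, p_t]` as the value at `t` of the distribution function of `δ_{α(t; P)}`.

Part (1) is then a quantile coupling. For a level `u` in `(0, 1]`, let `β_u(γ)` be the `u`-quantile
of `δ_γ`. These ballots are monotone in `γ`, and the rule they define selects a project at or before
`p` iff `u` is at most the relevant value of the distribution function. Only finitely many values
occur, so finitely many levels suffice, weighted by the gaps between consecutive values.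

In part (2), one direction holds because each min-max rule has the three properties and they survive
mixing. For the converse it suffices to reach a fixed group ballot rule. The core is
`IsStrategyProof.prob_eq_of_peak_mem`: if a voter's peak lies in an interval, only that fact matters
for the probability of the interval. The voter's preference is changed by swaps of neighbours on
opposite sides of the peak `x`. A swap can only shift mass between the two swapped projects. The
shifted amount stays the same while the other voters are moved one by one to peak `x`, where
unanimity makes it zero. Hence the probability of `[p_1, p_t]` is monotone in the set of voters with
peak in it, by anonymity it depends on `α(t; P)` only, and profiles with extreme peaks supply the
ballots `δ_γ`. -/

/-! ### Probabilities of sets and distribution functions -/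

theorem prob_nonneg {m : ℕ} (δ : stdSimplex ℝ (Fin m)) (A : Set (Fin m)) : 0 ≤ prob δ A :=
  Finset.sum_nonneg fun _ _ => Set.indicator_nonneg (fun x _ => δ.2.1 x) _

theorem prob_univ {m : ℕ} (δ : stdSimplex ℝ (Fin m)) : prob δ Set.univ = 1 := by
  simp only [prob, Set.indicator_univ]
  exact δ.2.2

theorem prob_empty {m : ℕ} (δ : stdSimplex ℝ (Fin m)) : prob δ ∅ = 0 := by
  simp [prob]

theorem prob_add_compl {m : ℕ} (δ : stdSimplex ℝ (Fin m)) (A : Set (Fin m)) :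
    prob δ A + prob δ Aᶜ = 1 := by
  rw [← prob_univ δ, prob, prob, prob, ← Finset.sum_add_distrib]
  refine Finset.sum_congr rfl fun p _ => ?_
  by_cases h : p ∈ A <;> simp [h]

theorem prob_insert {m : ℕ} (δ : stdSimplex ℝ (Fin m)) {A : Set (Fin m)} {c : Fin m}
    (hc : c ∉ A) : prob δ (insert c A) = δ.1 c + prob δ A := by
  have h : ∀ p, (insert c A).indicator δ.1 p = (if p = c then δ.1 p else 0) + A.indicator δ.1 p := by
    intro p
    by_cases hp : p = c
    · subst hp; simp [hc]
    · by_cases hA : p ∈ A <;> simp [hp, hA]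
  simp [prob, h, Finset.sum_add_distrib]

theorem prob_le_one {m : ℕ} (δ : stdSimplex ℝ (Fin m)) (A : Set (Fin m)) : prob δ A ≤ 1 := by
  linarith [prob_add_compl δ A, prob_nonneg δ Aᶜ]

theorem prob_mono {m : ℕ} (δ : stdSimplex ℝ (Fin m)) {A B : Set (Fin m)} (h : A ⊆ B) :
    prob δ A ≤ prob δ B :=
  Finset.sum_le_sum fun p _ => Set.indicator_le_indicator_of_subset h (fun x => δ.2.1 x) p

theorem cdf_zero {m : ℕ} (δ : stdSimplex ℝ (Fin m)) : cdf δ 0 = 0 := by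
  simp [cdf, prob_empty]

theorem cdf_of_le {m : ℕ} (δ : stdSimplex ℝ (Fin m)) {t : ℕ} (h : m ≤ t) : cdf δ t = 1 := by
  rw [cdf, ← prob_univ δ]
  congr 1
  ext p
  simpa using p.2.trans_le h

theorem cdf_mono {m : ℕ} (δ : stdSimplex ℝ (Fin m)) : Monotone (cdf δ) := fun _ _ h =>
  prob_mono δ fun _ hp => lt_of_lt_of_le hp h

theorem cdf_succ {m : ℕ} (δ : stdSimplex ℝ (Fin m)) (k : Fin m) :
    cdf δ (k + 1) = δ.1 k + cdf δ k := by
  rw [cdf, cdf, ← prob_insert δ (by simp)]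
  congr 1
  ext p
  simp only [Set.mem_ofPred_eq, Set.mem_insert_iff, Fin.ext_iff]
  omega

theorem eq_zero_of_ne {m : ℕ} {δ : stdSimplex ℝ (Fin m)} {p q : Fin m} (h : δ.1 p = 1)
    (hq : q ≠ p) : δ.1 q = 0 := by
  have h1 := prob_insert δ (A := {q}) (c := p) (by simpa using hq.symm)
  have h2 := prob_insert δ (A := ∅) (c := q) (by simp)
  have h3 := prob_le_one δ (insert p {q})
  have h4 := δ.2.1 q
  rw [prob_empty] at h2
  simp only [insert_empty_eq] at h2
  linarith

/-! ### Group min-max rules as threshold rules -/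

theorem tau_le_iff {n m g : ℕ} [NeZero m] (grp : Fin n → Fin g) (P : Profile n m) (q : Fin g)
    (t : Fin ((group grp q).card + 1)) (p : Fin m) :
    tau grp P q t ≤ p ↔ t ≤ alpha grp (p + 1) P q := by
  have hmono : ∀ p p' : Fin m, p ≤ p' →
      ((group grp q).filter fun i => (P i).1.peak ≤ p).card ≤
        ((group grp q).filter fun i => (P i).1.peak ≤ p').card := fun p p' h =>
    Finset.card_le_card (Finset.monotone_filter_right _ fun i _ hi => le_trans hi h)
  have halpha : (alpha grp (p + 1) P q : ℕ) =
      ((group grp q).filter fun i => (P i).1.peak ≤ p).card := by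
    simp only [alpha, Fin.le_def, Nat.lt_succ_iff]
  rw [Fin.le_def (a := t), halpha]
  constructor
  · intro h
    have h1 := Finset.min'_mem _ (tau_aux grp P q t)
    rw [Finset.mem_filter] at h1
    exact h1.2.trans (hmono _ _ h)
  · intro h
    exact Finset.min'_le _ _ (by simpa using h)

theorem alpha_val {n m g : ℕ} [NeZero m] (grp : Fin n → Fin g) (t : ℕ) (P : Profile n m)
    (q : Fin g) : (alpha grp t P q : ℕ) =
      ((group grp q).filter fun i => ((P i).1.peak : ℕ) < t).card := rfl

/-- A deterministic rule is a min-max rule with ballots `β` iff its outcome is among the first `t`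
projects exactly when the ballot of `α(t; P)` is. -/
theorem eq_minmax_iff {n m g : ℕ} [NeZero m] {grp : Fin n → Fin g} {β : Gam grp → Fin m}
    (hβ : ∀ γ γ' : Gam grp, γ' ≤ γ → β γ ≤ β γ') (P : Profile n m) (x : Fin m) :
    (x = Finset.univ.inf' Finset.univ_nonempty fun γ : Gam grp =>
        max (Finset.univ.sup fun q : Fin g => tau grp P q (γ q)) (β γ)) ↔
      ∀ p : Fin m, x ≤ p ↔ β (alpha grp (p + 1) P) ≤ p := by
  have key : ∀ p : Fin m, (Finset.univ.inf' Finset.univ_nonempty fun γ : Gam grp =>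
        max (Finset.univ.sup fun q : Fin g => tau grp P q (γ q)) (β γ)) ≤ p ↔
      β (alpha grp (p + 1) P) ≤ p := by
    intro p
    simp only [Finset.inf'_le_iff, Finset.mem_univ, true_and, max_le_iff, Finset.sup_le_iff,
      true_implies, tau_le_iff]
    constructor
    · rintro ⟨γ, h1, h2⟩
      exact (hβ _ _ h1).trans h2
    · intro h
      -- The vector `α` itself is the largest `γ` whose order statistics all lie at or before `p`,
      -- so by monotonicity it has the best ballot.
      exact ⟨_, fun _ => le_rfl, h⟩
  constructor
  · rintro rfl
    exact key
  · intro h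
    exact eq_of_forall_ge_iff fun p => (h p).trans (key p).symm

theorem isGMMR_iff {n m g : ℕ} [NeZero m] (grp : Fin n → Fin g) (f : DSCR n m) :
    IsGMMR grp f ↔ ∃ β : Gam grp → Fin m,
      β (gamBot grp) = ⊤ ∧ β (gamTop grp) = ⊥ ∧ (∀ γ γ' : Gam grp, γ' ≤ γ → β γ ≤ β γ') ∧
      ∀ P p, f P ≤ p ↔ β (alpha grp (p + 1) P) ≤ p := by
  refine exists_congr fun β => and_congr_right fun _ => and_congr_right fun _ =>
    and_congr_right fun h => forall_congr' fun P => eq_minmax_iff h P _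

/-! ### Probabilistic fixed group ballot rules are random group min-max rules -/

/-- The smallest project at which the distribution function reaches `u`. -/
theorem exists_quantile {m : ℕ} (δ : stdSimplex ℝ (Fin m)) {u : ℝ} (h0 : 0 < u) (h1 : u ≤ 1) :
    ∃ b : Fin m, ∀ p : Fin m, b ≤ p ↔ u ≤ cdf δ (p + 1) := by
  classical
  have hex : ∃ t, u ≤ cdf δ t := ⟨m, by rwa [cdf_of_le δ le_rfl]⟩
  -- Positivity of `u` excludes `t = 0`, so the project with index `t - 1` exists.
  have hpos : 0 < Nat.find hex := by
    rw [Nat.pos_iff_ne_zero]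
    intro h
    have := Nat.find_spec hex
    rw [h, cdf_zero] at this
    linarith
  have hle : Nat.find hex ≤ m := Nat.find_min' hex (by rwa [cdf_of_le δ le_rfl])
  refine ⟨⟨Nat.find hex - 1, by omega⟩, fun p => ?_⟩
  rw [Fin.le_def, Nat.sub_le_iff_le_add, Nat.find_le_iff]
  exact ⟨fun ⟨t, ht, h⟩ => h.trans (cdf_mono δ ht), fun h => ⟨_, le_rfl, h⟩⟩

/-- The weight of `u` is its distance to the preceding element of `S` (to `0` for the least one), so
partial sums telescope. -/
theorem exists_weights (S : Finset ℝ) (hS : ∀ u ∈ S, 0 < u) :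
    ∃ lam : ℝ → ℝ, (∀ u ∈ S, 0 ≤ lam u) ∧ ∀ c ∈ S, ∑ u ∈ S with u ≤ c, lam u = c := by
  -- The extra bound on the total weight makes the weight of a newly added maximum nonnegative.
  suffices H : ∃ lam : ℝ → ℝ, (∀ u ∈ S, 0 ≤ lam u) ∧ (∀ c ∈ S, ∑ u ∈ S with u ≤ c, lam u = c) ∧
      ∀ b : ℝ, 0 ≤ b → (∀ u ∈ S, u ≤ b) → ∑ u ∈ S, lam u ≤ b by
    obtain ⟨lam, h1, h2, -⟩ := H
    exact ⟨lam, h1, h2⟩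
  induction S using Finset.induction_on_max with
  | empty => exact ⟨0, by simp, by simp, by simp⟩
  | insert a S ha ih =>
    obtain ⟨lam, h1, h2, h3⟩ := ih fun u hu => hS u (Finset.mem_insert_of_mem hu)
    have haS : a ∉ S := fun h => lt_irrefl _ (ha a h)
    have ha0 : 0 < a := hS a (Finset.mem_insert_self _ _)
    have hne : ∀ u ∈ S, u ≠ a := fun u hu => (ha u hu).ne
    have hsum : ∀ T ⊆ S, ∑ u ∈ T, Function.update lam a (a - ∑ u ∈ S, lam u) u =
        ∑ u ∈ T, lam u := fun T hT =>
      Finset.sum_congr rfl fun u hu => Function.update_of_ne (hne u (hT hu)) _ _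
    have htot : ∑ u ∈ insert a S, Function.update lam a (a - ∑ u ∈ S, lam u) u = a := by
      rw [Finset.sum_insert haS, hsum S subset_rfl]
      simp
    refine ⟨Function.update lam a (a - ∑ u ∈ S, lam u), fun u hu => ?_, fun c hc => ?_, ?_⟩
    · rcases Finset.mem_insert.1 hu with rfl | hu
      · simpa using h3 u ha0.le fun v hv => (ha v hv).le
      · rw [Function.update_of_ne (hne u hu)]
        exact h1 u hu
    · rcases Finset.mem_insert.1 hc with rfl | hc
      · rw [Finset.filter_true_of_mem, htot]
        intro u hu
        rcases Finset.mem_insert.1 hu with rfl | hu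
        exacts [le_rfl, (ha u hu).le]
      · rw [Finset.filter_insert, if_neg (not_le.2 (ha c hc)), hsum _ (Finset.filter_subset _ _)]
        exact h2 c hc
    · intro b _ hb
      rw [htot]
      exact hb a (Finset.mem_insert_self _ _)

theorem IsPFGBR.isRandomGMMR {n m g : ℕ} [NeZero m] {grp : Fin n → Fin g} {φ : RSCR n m}
    (h : IsPFGBR grp φ) : IsRandomGMMR grp φ := by
  classical
  obtain ⟨δ, ⟨hbot, htop⟩, hmono, hφ⟩ := h
  -- All positive values of the distribution functions serve as levels; the level `1` makes the
  -- total weight `1`.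
  let S : Finset ℝ := insert 1 ((Finset.univ.image fun x : Gam grp × Fin m =>
    cdf (δ x.1) (x.2 + 1)).filter (0 < ·))
  have hS0 : ∀ u ∈ S, 0 < u := by
    intro u hu
    rcases Finset.mem_insert.1 hu with rfl | hu
    exacts [one_pos, (Finset.mem_filter.1 hu).2]
  have hS1 : ∀ u ∈ S, u ≤ 1 := by
    intro u hu
    rcases Finset.mem_insert.1 hu with rfl | hu
    · exact le_rfl
    · obtain ⟨x, -, rfl⟩ := Finset.mem_image.1 (Finset.mem_filter.1 hu).1
      exact prob_le_one _ _
  obtain ⟨lam, hlam, hsum⟩ := exists_weights S hS0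
  have htot : ∑ u ∈ S, lam u = 1 := by
    rw [← hsum 1 (Finset.mem_insert_self _ _), Finset.filter_true_of_mem hS1]
  have hq : ∀ u ∈ S, ∀ γ : Gam grp, ∃ b : Fin m, ∀ p : Fin m, b ≤ p ↔ u ≤ cdf (δ γ) (p + 1) :=
    fun u hu γ => exists_quantile _ (hS0 u hu) (hS1 u hu)
  choose! β hβ using hq
  have hβm : ∀ u ∈ S, ∀ γ γ' : Gam grp, γ' ≤ γ → β u γ ≤ β u γ' := by
    intro u hu γ γ' hγ
    rw [hβ u hu]
    exact ((hβ u hu _ _).1 le_rfl).trans (hmono γ γ' hγ _ (by omega) (by omega))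
  let f : ℝ → DSCR n m := fun u P => Finset.univ.inf' Finset.univ_nonempty fun γ : Gam grp =>
    max (Finset.univ.sup fun q : Fin g => tau grp P q (γ q)) (β u γ)
  have hf : ∀ u ∈ S, ∀ P p, f u P ≤ p ↔ β u (alpha grp (p + 1) P) ≤ p := fun u hu P =>
    (eq_minmax_iff (hβm u hu) P _).1 rfl
  have hG : ∀ u ∈ S, IsGMMR grp (f u) := by
    intro u hu
    refine ⟨β u, top_unique ?_, bot_unique ?_, hβm u hu, fun P => rfl⟩
    -- Otherwise mass at least `u > 0` would lie before `⊤`, which already carries mass `1`.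
    · by_contra hlt
      rw [not_le] at hlt
      have h1 := (hβ u hu _ _).1 (le_refl (β u (gamBot grp)))
      have h2 := prob_insert (δ (gamBot grp)) (c := ⊤)
        (A := {p : Fin m | (p : ℕ) < β u (gamBot grp) + 1}) (by
          simpa using hlt.ne)
      have h3 := prob_le_one (δ (gamBot grp)) (insert ⊤ {p : Fin m | (p : ℕ) < β u (gamBot grp) + 1})
      rw [cdf] at h1
      linarith [hS0 u hu]
    · rw [hβ u hu]
      refine (hS1 u hu).trans ?_
      rw [cdf_succ, htop]
      linarith [prob_nonneg (δ (gamTop grp)) {p | (p : ℕ) < (⊥ : Fin m)},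
        show cdf (δ (gamTop grp)) (⊥ : Fin m) =
          prob (δ (gamTop grp)) {p | (p : ℕ) < (⊥ : Fin m)} from rfl]
  have hle : ∀ (P : Profile n m) (p : Fin m), ∑ u ∈ S, lam u * (if f u P ≤ p then 1 else 0) =
      cdf (δ (alpha grp (p + 1) P)) (p + 1) := by
    intro P p
    set c := cdf (δ (alpha grp (p + 1) P)) (p + 1) with hc
    have h1 : ∀ u ∈ S, lam u * (if f u P ≤ p then 1 else 0) = if u ≤ c then lam u else 0 := by
      intro u hu
      simp only [hf u hu, hβ u hu, mul_ite, mul_one, mul_zero, ← hc]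
    rw [Finset.sum_congr rfl h1, ← Finset.sum_filter]
    have hc0 : 0 ≤ c := prob_nonneg _ _
    rcases hc0.lt_or_eq with h0 | h0
    · refine hsum c (Finset.mem_insert_of_mem (Finset.mem_filter.2 ⟨?_, h0⟩))
      exact Finset.mem_image.2 ⟨(alpha grp (p + 1) P, p), Finset.mem_univ _, rfl⟩
    · rw [Finset.filter_false_of_mem, Finset.sum_empty, h0]
      intro u hu
      rw [← h0, not_le]
      exact hS0 u hu
  have hlt : ∀ (P : Profile n m) (k : Fin m), ∑ u ∈ S, lam u * (if f u P < k then 1 else 0) =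
      cdf (δ (alpha grp k P)) k := by
    rintro P ⟨k, hk⟩
    cases k with
    | zero => simp [cdf_zero]
    | succ k =>
      rw [← hle P ⟨k, by omega⟩]
      simp [Fin.lt_def, Fin.le_def]
  have hfin : ∀ (P : Profile n m) (p : Fin m), (φ P).1 p =
      ∑ u ∈ S, lam u * (if f u P = p then 1 else 0) := by
    intro P p
    rw [hφ, ← hle, ← hlt, ← Finset.sum_sub_distrib]
    refine Finset.sum_congr rfl fun u _ => ?_
    rcases lt_trichotomy (f u P) p with h | h | h
    · simp [h, h.le, h.ne]
    · simp [h]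
    · simp [h.not_ge, h.not_gt, h.ne']
  let e := S.equivFin
  have hre : ∀ F : ℝ → ℝ, ∑ w : Fin S.card, F (e.symm w) = ∑ u ∈ S, F u := by
    intro F
    rw [Equiv.sum_comp e.symm (fun u : S => F u), Finset.sum_coe_sort S F]
  refine ⟨S.card, fun w => lam (e.symm w), fun w => f (e.symm w), fun w => ⟨?_, ?_⟩, ?_, ?_, ?_⟩
  · exact hlam _ (e.symm w).2
  · rw [← htot]
    exact Finset.single_le_sum (f := lam) hlam (e.symm w).2
  · rw [hre lam, htot]
  · exact fun w _ => hG _ (e.symm w).2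
  · intro P p
    rw [hfin P p, ← hre fun u => lam u * (if f u P = p then 1 else 0)]

/-! ### Random group min-max rules are unanimous, strategy-proof and group-wise anonymous -/

theorem alpha_comp {n m g : ℕ} [NeZero m] {grp : Fin n → Fin g} {π : Equiv.Perm (Fin n)}
    (hπ : ∀ i, grp (π i) = grp i) (t : ℕ) (P : Profile n m) :
    alpha grp t (fun i => P (π i)) = alpha grp t P := by
  refine funext fun q => Fin.ext ?_
  rw [alpha_val, alpha_val]
  refine Finset.card_bij (fun i _ => π i) ?_ (fun _ _ _ _ h => π.injective h) ?_
  · intro i hi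
    simpa [group, hπ] using hi
  · intro i hi
    refine ⟨π.symm i, ?_, by simp⟩
    have := hπ (π.symm i)
    rw [Equiv.apply_symm_apply] at this
    simpa [group, ← this] using hi

theorem alpha_le_alpha {n m g : ℕ} [NeZero m] {grp : Fin n → Fin g} {t : ℕ} {P Q : Profile n m}
    (h : ∀ i, ((P i).1.peak : ℕ) < t → ((Q i).1.peak : ℕ) < t) : alpha grp t P ≤ alpha grp t Q :=
  fun q => by
    rw [Fin.le_def, alpha_val, alpha_val]
    exact Finset.card_le_card (Finset.monotone_filter_right _ fun i _ hi => h i hi)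

theorem IsGMMR.comp_perm {n m g : ℕ} [NeZero m] {grp : Fin n → Fin g} {f : DSCR n m}
    (h : IsGMMR grp f) {π : Equiv.Perm (Fin n)} (hπ : ∀ i, grp (π i) = grp i) (P : Profile n m) :
    f (fun i => P (π i)) = f P := by
  obtain ⟨β, -, -, -, hf⟩ := (isGMMR_iff grp f).1 h
  refine eq_of_forall_ge_iff fun p => ?_
  rw [hf, hf, alpha_comp hπ]

theorem IsGMMR.eq_of_unanimous {n m g : ℕ} [NeZero m] {grp : Fin n → Fin g} {f : DSCR n m}
    (h : IsGMMR grp f) {P : Profile n m} {x : Fin m} (hP : ∀ i, (P i).1.peak = x) : f P = x := by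
  obtain ⟨β, hbot, htop, -, hf⟩ := (isGMMR_iff grp f).1 h
  refine eq_of_forall_ge_iff fun p => ?_
  rw [hf]
  by_cases hp : x ≤ p
  · have : alpha grp (p + 1) P = gamTop grp := by
      ext q
      simp only [alpha, gamTop, Fin.val_last, hP]
      rw [Finset.filter_true_of_mem]
      exact fun _ _ => Nat.lt_succ_of_le hp
    simp [this, htop, hp]
  · have : alpha grp (p + 1) P = gamBot grp := by
      ext q
      simp only [alpha, gamBot, hP]
      rw [Finset.filter_false_of_mem]
      · simp
      · exact fun _ _ h => hp (Nat.le_of_lt_succ h)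
    simp only [this, hbot, hp, iff_false, not_le]
    exact lt_of_lt_of_le (not_le.1 hp) le_top

theorem Pref.rel_of_between {m : ℕ} [NeZero m] {r : Pref m} (h : r.IsSinglePeaked) {p p' : Fin m}
    (hp : (r.peak ≤ p ∧ p ≤ p') ∨ (p' ≤ p ∧ p ≤ r.peak)) : r.rel p p' := by
  by_cases h1 : p = p'
  · exact h1 ▸ r.refl p
  by_cases h2 : r.peak = p
  · exact h2 ▸ r.rel_peak p'
  refine (h p p' ?_).1
  rcases hp with ⟨a, b⟩ | ⟨a, b⟩
  · exact Or.inl ⟨lt_of_le_of_ne a h2, lt_of_le_of_ne b h1⟩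
  · exact Or.inr ⟨lt_of_le_of_ne a (Ne.symm h1), lt_of_le_of_ne b (Ne.symm h2)⟩

/-- A misreport can only move the outcome away from the true peak on the same side: at thresholds
strictly between peak and outcome the voter is already counted truthfully in the way that pulls the
outcome closer. -/
theorem IsGMMR.rel_update {n m g : ℕ} [NeZero m] {grp : Fin n → Fin g} {f : DSCR n m}
    (h : IsGMMR grp f) (i : Fin n) (P : Profile n m) (r' : SPDomain m) :
    (P i).1.rel (f P) (f (Function.update P i r')) := by
  obtain ⟨β, -, -, hβ, hf⟩ := (isGMMR_iff grp f).1 h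
  by_cases he : (P i).1.peak = f P
  · exact he ▸ (P i).1.rel_peak _
  refine Pref.rel_of_between (P i).2 ?_
  rcases le_total (P i).1.peak (f P) with hx | hx
  · refine Or.inl ⟨hx, ?_⟩
    by_contra! hlt
    -- The threshold is the larger of the new outcome and the true peak: there the voter is counted
    -- at `P`, so `α` at `P` dominates, and `f P` would lie at or before it.
    refine (max_lt hlt (lt_of_le_of_ne hx he)).not_ge ((hf P _).2 ((hβ _ _ (alpha_le_alpha
      fun j hj => ?_)).trans ((hf (Function.update P i r') _).1 (le_max_left _ _))))
    by_cases hji : j = i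
    · subst hji
      exact Nat.lt_succ_of_le (le_max_right _ _)
    · rwa [Function.update_of_ne hji] at hj
  · refine Or.inr ⟨(hf _ _).2 ((hβ _ _ (alpha_le_alpha fun j hj => ?_)).trans
      ((hf P _).1 le_rfl)), hx⟩
    by_cases hji : j = i
    · subst hji
      exact absurd (le_antisymm (Fin.le_def.2 (Nat.le_of_lt_succ hj)) hx) he
    · rwa [Function.update_of_ne hji]

theorem prob_eq_sum {m W : ℕ} {δ : stdSimplex ℝ (Fin m)} {lam : Fin W → ℝ} {x : Fin W → Fin m}
    (h : ∀ p, δ.1 p = ∑ w, lam w * (if x w = p then 1 else 0)) (A : Set (Fin m)) :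
    prob δ A = ∑ w, lam w * A.indicator 1 (x w) := by
  classical
  have h1 : ∀ p, A.indicator δ.1 p =
      ∑ w, lam w * (if x w = p then A.indicator 1 (x w) else 0) := by
    intro p
    by_cases hp : p ∈ A
    · rw [Set.indicator_of_mem hp, h]
      refine Finset.sum_congr rfl fun w _ => ?_
      split_ifs with hw
      · rw [hw, Set.indicator_of_mem hp, Pi.one_apply]
      · rfl
    · rw [Set.indicator_of_notMem hp]
      symm
      refine Finset.sum_eq_zero fun w _ => ?_
      split_ifs with hw
      · rw [hw, Set.indicator_of_notMem hp, mul_zero]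
      · exact mul_zero _
  simp only [prob, h1]
  rw [Finset.sum_comm]
  refine Finset.sum_congr rfl fun w _ => ?_
  rw [← Finset.mul_sum]
  simp

theorem IsRandomGMMR.isUnanimous {n m g : ℕ} [NeZero m] {grp : Fin n → Fin g} {φ : RSCR n m}
    (h : IsRandomGMMR grp φ) : IsUnanimous φ := by
  obtain ⟨W, lam, f, h01, hsum, hG, hφ⟩ := h
  intro p P hP
  rw [hφ]
  refine (Finset.sum_congr rfl fun w _ => ?_).trans hsum
  rcases (h01 w).1.lt_or_eq with hw | hw
  · rw [(hG w hw).eq_of_unanimous hP, if_pos rfl, mul_one]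
  · rw [← hw, zero_mul]

theorem IsRandomGMMR.isGroupwiseAnonymous {n m g : ℕ} [NeZero m] {grp : Fin n → Fin g}
    {φ : RSCR n m} (h : IsRandomGMMR grp φ) : IsGroupwiseAnonymous grp φ := by
  obtain ⟨W, lam, f, h01, hsum, hG, hφ⟩ := h
  intro π hπ P
  refine Subtype.ext (funext fun p => ?_)
  rw [hφ, hφ]
  refine Finset.sum_congr rfl fun w _ => ?_
  rcases (h01 w).1.lt_or_eq with hw | hw
  · rw [(hG w hw).comp_perm hπ]
  · rw [← hw, zero_mul, zero_mul]

theorem IsRandomGMMR.isStrategyProof {n m g : ℕ} [NeZero m] {grp : Fin n → Fin g}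
    {φ : RSCR n m} (h : IsRandomGMMR grp φ) : IsStrategyProof φ := by
  classical
  obtain ⟨W, lam, f, h01, hsum, hG, hφ⟩ := h
  intro i P r' p
  rw [prob_eq_sum (hφ P), prob_eq_sum (hφ (Function.update P i r'))]
  refine Finset.sum_le_sum fun w _ => ?_
  rcases (h01 w).1.lt_or_eq with hw | hw
  · refine mul_le_mul_of_nonneg_left ?_ hw.le
    by_cases hmem : f w (Function.update P i r') ∈ (P i).1.upperContour p
    · have : f w P ∈ (P i).1.upperContour p :=
        (P i).1.trans _ _ _ ((hG w hw).rel_update i P r') hmem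
      simp [hmem, this]
    · rw [Set.indicator_of_notMem hmem]
      exact Set.indicator_nonneg (fun _ _ => zero_le_one) _
  · simp [← hw]

/-! ### Upper sets of a preference and construction of single-peaked preferences -/

/-- `U` contains every project at least as good as some member of `U`. -/
def Pref.IsUpper {m : ℕ} (r : Pref m) (U : Set (Fin m)) : Prop :=
  ∀ p p', p ∈ U → r.rel p' p → p' ∈ U

theorem Pref.exists_cost {m : ℕ} (r : Pref m) :
    ∃ c : Fin m → ℕ, ∀ p p', r.rel p p' ↔ c p ≤ c p' := by
  classical
  -- The cost is the rank: the number of projects at least as good as `p`.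
  refine ⟨fun p => (Finset.univ.filter fun q => r.rel q p).card, fun p p' => ⟨fun h => ?_,
    fun h => ?_⟩⟩
  · exact Finset.card_le_card (Finset.monotone_filter_right _ fun q _ hq => r.trans _ _ _ hq h)
  · by_contra hn
    have hp : r.rel p' p := (r.complete p p').resolve_left hn
    refine absurd h (not_le.2 (Finset.card_lt_card ?_))
    rw [Finset.ssubset_iff_of_subset
      (Finset.monotone_filter_right _ fun q _ hq => r.trans _ _ _ hq hp)]
    exact ⟨p, by simp [r.refl], by simpa using hn⟩

theorem Pref.isUpper_upperContour {m : ℕ} (r : Pref m) (p : Fin m) :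
    r.IsUpper (r.upperContour p) := fun _ _ hq h => r.trans _ _ _ h hq

theorem Pref.IsUpper.exists_eq_upperContour {m : ℕ} {r : Pref m} {U : Set (Fin m)}
    (hU : r.IsUpper U) (hne : U.Nonempty) : ∃ p, U = r.upperContour p := by
  obtain ⟨c, hc⟩ := r.exists_cost
  obtain ⟨p, hp, hmax⟩ := Set.exists_max_image U c U.toFinite hne
  refine ⟨p, Set.ext fun q => ⟨fun hq => (hc _ _).2 (hmax q hq), fun hq => hU _ _ hp hq⟩⟩

theorem Pref.IsUpper.peak_mem {m : ℕ} [NeZero m] {r : Pref m} {U : Set (Fin m)}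
    (hU : r.IsUpper U) (hne : U.Nonempty) : r.peak ∈ U :=
  hU _ _ hne.some_mem (r.rel_peak _)

theorem Pref.IsUpper.ordConnected {m : ℕ} [NeZero m] {r : Pref m} {U : Set (Fin m)}
    (hU : r.IsUpper U) (h : r.IsSinglePeaked) : U.OrdConnected := by
  refine ⟨fun p hp q hq z hz => ?_⟩
  rcases le_total r.peak z with hx | hx
  · exact hU _ _ hq (Pref.rel_of_between h (Or.inl ⟨hx, hz.2⟩))
  · exact hU _ _ hp (Pref.rel_of_between h (Or.inr ⟨hz.1, hx⟩))

theorem Pref.peak_eq {m : ℕ} [NeZero m] {r : Pref m} {x : Fin m} (h : ∀ p, r.rel x p) :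
    r.peak = x := r.antisymm _ _ (r.rel_peak _) (h _)

/-- The preference that orders the projects by increasing cost. -/
def Pref.ofCost {m : ℕ} (c : Fin m → ℕ) (hc : Function.Injective c) : Pref m where
  rel p p' := c p ≤ c p'
  complete _ _ := le_total _ _
  refl _ := le_rfl
  antisymm _ _ h h' := hc (le_antisymm h h')
  trans _ _ _ := le_trans

/-- Projects are ordered first by how many of the nested sets `U ⊆ V` they lie outside, then by
distance to `x`. Both sets are intervals containing `x`, so neither criterion improves when moving
away from `x`. -/
theorem exists_singlePeaked {m : ℕ} [NeZero m] {x : Fin m} {U V : Set (Fin m)}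
    (hU : U.OrdConnected) (hV : V.OrdConnected) (hx : x ∈ U) (hUV : U ⊆ V) :
    ∃ r : SPDomain m, r.1.peak = x ∧ r.1.IsUpper U ∧ r.1.IsUpper V := by
  classical
  -- Distance `d` gets code `2d` to the right of `x` and `2d - 1` to the left, which breaks ties.
  let code : Fin m → ℕ := fun p => if x ≤ p then 2 * ((p : ℕ) - x) else 2 * ((x : ℕ) - p) - 1
  let level : Fin m → ℕ := fun p => (if p ∈ U then 0 else 1) + (if p ∈ V then 0 else 1)
  have hcode : ∀ p, code p < 2 * m := by
    intro p
    have := p.2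
    have := x.2
    simp only [code]
    split_ifs <;> omega
  have hinj : ∀ p q, code p = code q → p = q := by
    intro p q h
    simp only [code, Fin.le_def] at h
    split_ifs at h <;> ext <;> omega
  let c : Fin m → ℕ := fun p => 2 * m * level p + code p
  have hc : ∀ p q, level p < level q → c p < c q := by
    intro p q h
    have h1 : 2 * m * (level p + 1) ≤ 2 * m * level q := Nat.mul_le_mul_left _ h
    have h2 := hcode p
    simp only [c]
    rw [mul_add, mul_one] at h1
    omega
  have hcinj : Function.Injective c := by
    intro p q h
    rcases lt_trichotomy (level p) (level q) with h1 | h1 | h1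
    · exact absurd h (hc _ _ h1).ne
    · simp only [c, h1] at h
      exact hinj p q (by omega)
    · exact absurd h (hc _ _ h1).ne'
  have hle : ∀ p q, c p ≤ c q → level p ≤ level q := fun p q h => by
    by_contra! h1
    exact (hc _ _ h1).not_ge h
  have hup : (Pref.ofCost c hcinj).IsUpper U ∧ (Pref.ofCost c hcinj).IsUpper V := by
    constructor <;> intro p p' hp h <;> by_contra hp' <;> have h1 := hle _ _ h
    · have : p ∈ V := hUV hp
      simp [level, *] at h1
    · have : p' ∉ U := fun h => hp' (hUV h)
      simp only [level, hp, hp', this, if_false, if_true] at h1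
      split_ifs at h1 <;> omega
  have hpeak : (Pref.ofCost c hcinj).peak = x := Pref.peak_eq fun p => by
    have : c x = 0 := by simp [c, level, code, hx, hUV hx]
    exact this.trans_le (Nat.zero_le _)
  refine ⟨⟨Pref.ofCost c hcinj, ?_⟩, hpeak, hup⟩
  intro p p' h
  rw [hpeak] at h
  have hne : p ≠ p' := by
    rintro rfl
    rcases h with ⟨_, h⟩ | ⟨h, _⟩ <;> exact lt_irrefl _ h
  refine ⟨?_, hne⟩
  have hmem : ∀ W : Set (Fin m), W.OrdConnected → x ∈ W → p' ∈ W → p ∈ W := by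
    intro W hW hxW hpW
    rcases h with ⟨h1, h2⟩ | ⟨h1, h2⟩
    · exact hW.out hxW hpW ⟨h1.le, h2.le⟩
    · exact hW.out hpW hxW ⟨h1.le, h2.le⟩
  have hlev : level p ≤ level p' := by
    have h1 := hmem U hU hx
    have h2 := hmem V hV (hUV hx)
    simp only [level]
    refine add_le_add ?_ ?_ <;> split_ifs <;> simp_all
  have hcd : code p ≤ code p' := by
    simp only [code, Fin.le_def]
    simp only [Fin.lt_def] at h
    split_ifs <;> omega
  exact add_le_add (Nat.mul_le_mul_left _ hlev) hcd

/-! ### Consequences of strategy-proofness -/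

theorem IsStrategyProof.prob_le {n m : ℕ} [NeZero m] {φ : RSCR n m} (h : IsStrategyProof φ)
    {i : Fin n} {P : Profile n m} {U : Set (Fin m)} (r r' : SPDomain m) (hU : r.1.IsUpper U) :
    prob (φ (Function.update P i r')) U ≤ prob (φ (Function.update P i r)) U := by
  rcases U.eq_empty_or_nonempty with rfl | hne
  · rw [prob_empty, prob_empty]
  · obtain ⟨p, rfl⟩ := hU.exists_eq_upperContour hne
    have := h i (Function.update P i r) r' p
    rwa [Function.update_self, Function.update_idem] at this

theorem IsStrategyProof.prob_eq {n m : ℕ} [NeZero m] {φ : RSCR n m} (h : IsStrategyProof φ)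
    {i : Fin n} {P : Profile n m} {U : Set (Fin m)} {r r' : SPDomain m} (hU : r.1.IsUpper U)
    (hU' : r'.1.IsUpper U) :
    prob (φ (Function.update P i r)) U = prob (φ (Function.update P i r')) U :=
  le_antisymm (h.prob_le _ _ hU') (h.prob_le _ _ hU)

theorem prob_sub_prob {m : ℕ} {δ δ' : stdSimplex ℝ (Fin m)} {a b : Fin m}
    (h : ∀ c, c ≠ a → c ≠ b → δ.1 c = δ'.1 c) {U : Set (Fin m)} (ha : a ∈ U) (hb : b ∉ U) :
    prob δ U - prob δ' U = δ.1 a - δ'.1 a := by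
  rw [prob, prob, ← Finset.sum_sub_distrib, Finset.sum_eq_single a]
  · simp [ha]
  · intro c _ hc
    by_cases hU : c ∈ U
    · rw [Set.indicator_of_mem hU, Set.indicator_of_mem hU,
        h c hc (by rintro rfl; exact hb hU), sub_self]
    · simp [hU]
  · simp

/-- If the two preferences `r` and `r'` of voter `i`, with common peak `x`, can only affect the
probabilities of two projects `a` and `b` on different sides of `x`, then the difference they make
does not change when another voter `j` adopts a suitable preference with peak `x`. -/
theorem IsStrategyProof.exists_update_peak {n m : ℕ} [NeZero m] {φ : RSCR n m}
    (h : IsStrategyProof φ) {i j : Fin n} (hij : j ≠ i) {r r' : SPDomain m} {a b x : Fin m}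
    (hc : ∀ P c, c ≠ a → c ≠ b →
      (φ (Function.update P i r)).1 c = (φ (Function.update P i r')).1 c)
    (hax : a < x) (hxb : x < b) (P : Profile n m) :
    ∃ s : SPDomain m, s.1.peak = x ∧
      (φ (Function.update (Function.update P j s) i r)).1 a -
        (φ (Function.update (Function.update P j s) i r')).1 a =
      (φ (Function.update P i r)).1 a - (φ (Function.update P i r')).1 a := by
  have hc' : ∀ P c, c ≠ b → c ≠ a →
      (φ (Function.update P i r)).1 c = (φ (Function.update P i r')).1 c :=
    fun P c h1 h2 => hc P c h2 h1
  have hab := hax.trans hxb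
  have key : ∀ (s s' : SPDomain m) (U : Set (Fin m)),
      s.1.IsUpper U → s'.1.IsUpper U → (a ∈ U ∧ b ∉ U ∨ b ∈ U ∧ a ∉ U) →
      (φ (Function.update (Function.update P j s) i r)).1 a -
        (φ (Function.update (Function.update P j s) i r')).1 a =
      (φ (Function.update (Function.update P j s') i r)).1 a -
        (φ (Function.update (Function.update P j s') i r')).1 a := by
    intro s s' U hs hs' hU
    have h1 : ∀ t, prob (φ (Function.update (Function.update P j s) i t)) U =
        prob (φ (Function.update (Function.update P j s') i t)) U := by
      intro t
      rw [Function.update_comm hij, Function.update_comm hij]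
      exact h.prob_eq hs hs'
    rcases hU with ⟨ha, hb⟩ | ⟨hb, ha⟩
    · rw [← prob_sub_prob (hc _) ha hb, ← prob_sub_prob (hc _) ha hb, h1, h1]
    -- Total mass is `1`, so the changes at `a` and `b` are opposite.
    · have h2 : ∀ t : SPDomain m, (φ (Function.update (Function.update P j t) i r)).1 a -
          (φ (Function.update (Function.update P j t) i r')).1 a =
          -(prob (φ (Function.update (Function.update P j t) i r)) U -
            prob (φ (Function.update (Function.update P j t) i r')) U) := by
        intro t
        rw [prob_sub_prob (hc' _) hb ha]
        have h3 := prob_sub_prob (hc (Function.update P j t)) (U := {b}ᶜ) hab.ne (by simp)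
        have h4 := fun δ : stdSimplex ℝ (Fin m) => prob_add_compl δ {b}
        have h5 := fun δ : stdSimplex ℝ (Fin m) => prob_insert δ (A := ∅) (c := b) (by simp)
        simp only [insert_empty_eq, prob_empty, add_zero] at h5
        have h6 := h4 (φ (Function.update (Function.update P j t) i r))
        have h7 := h4 (φ (Function.update (Function.update P j t) i r'))
        rw [h5] at h6 h7
        linarith
      rw [h2, h2, h1, h1]
  have hself : P = Function.update P j (P j) := (Function.update_eq_self j P).symm
  -- `U` is the upper contour set of the better of `a` and `b` for voter `j`; `V` is the ray cut off
  -- at the worse one, which also contains `x`. Voter `j` goes from `P j` to `s₁` preserving the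
  -- probability of `U`, then to `s₂` with peak `x` preserving that of `V`.
  obtain ⟨U, V, hU, hV, hUne, hUV, hUab, hVab, hxV⟩ : ∃ U V : Set (Fin m), (P j).1.IsUpper U ∧
      V.OrdConnected ∧ U.Nonempty ∧ U ⊆ V ∧ (a ∈ U ∧ b ∉ U ∨ b ∈ U ∧ a ∉ U) ∧
      (a ∈ V ∧ b ∉ V ∨ b ∈ V ∧ a ∉ V) ∧ x ∈ V := by
    have hne : ∀ p q, p ≠ q → (P j).1.rel p q → q ∉ (P j).1.upperContour p :=
      fun p q hpq h1 h2 => hpq ((P j).1.antisymm _ _ h1 h2)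
    rcases (P j).1.complete a b with hr | hr
    · have hU := (P j).1.isUpper_upperContour a
      have haU : a ∈ (P j).1.upperContour a := (P j).1.refl a
      have hbU := hne a b hab.ne hr
      refine ⟨_, Set.Iio b, hU, Set.ordConnected_Iio, ⟨a, haU⟩, fun q hq => ?_,
        Or.inl ⟨haU, hbU⟩, Or.inl ⟨hab, lt_irrefl b⟩, hxb⟩
      by_contra hqb
      exact hbU ((hU.ordConnected (P j).2).out haU hq ⟨hab.le, not_lt.1 hqb⟩)
    · have hU := (P j).1.isUpper_upperContour b
      have hbU : b ∈ (P j).1.upperContour b := (P j).1.refl b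
      have haU := hne b a hab.ne' hr
      refine ⟨_, Set.Ioi a, hU, Set.ordConnected_Ioi, ⟨b, hbU⟩, fun q hq => ?_,
        Or.inr ⟨hbU, haU⟩, Or.inr ⟨hab, lt_irrefl a⟩, hax⟩
      by_contra hqa
      exact haU ((hU.ordConnected (P j).2).out hq hbU ⟨not_lt.1 hqa, hab.le⟩)
  obtain ⟨s₁, -, hs₁U, hs₁V⟩ :=
    exists_singlePeaked (hU.ordConnected (P j).2) hV (hU.peak_mem hUne) hUV
  obtain ⟨s₂, hs₂, hs₂V, -⟩ := exists_singlePeaked hV hV hxV subset_rfl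
  refine ⟨s₂, hs₂, ?_⟩
  rw [key s₂ s₁ V hs₂V hs₁V hVab, key s₁ (P j) U hs₁U hU hUab, ← hself]

/-- Moving all other voters to peak `x` keeps the difference at `a`; at the resulting unanimous
profiles both terms vanish. Total mass then forces equality at `b`. -/
theorem IsStrategyProof.apply_update_eq {n m : ℕ} [NeZero m] {φ : RSCR n m}
    (h : IsStrategyProof φ) (hu : IsUnanimous φ) {i : Fin n} {r r' : SPDomain m} {a b x : Fin m}
    (hc : ∀ P c, c ≠ a → c ≠ b →
      (φ (Function.update P i r)).1 c = (φ (Function.update P i r')).1 c)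
    (hr : r.1.peak = x) (hr' : r'.1.peak = x) (hax : a < x) (hxb : x < b) (P : Profile n m)
    (L : Set (Fin m)) :
    prob (φ (Function.update P i r)) L = prob (φ (Function.update P i r')) L := by
  have key : ∀ T : Finset (Fin n), i ∉ T → ∃ Q : Profile n m, (∀ j ∈ T, (Q j).1.peak = x) ∧
      (φ (Function.update Q i r)).1 a - (φ (Function.update Q i r')).1 a =
      (φ (Function.update P i r)).1 a - (φ (Function.update P i r')).1 a := by
    intro T
    induction T using Finset.induction_on with
    | empty => exact fun _ => ⟨P, by simp, rfl⟩
    | insert j T hj ih =>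
      intro hi
      rw [Finset.mem_insert, not_or] at hi
      obtain ⟨Q, hQ, hD⟩ := ih hi.2
      obtain ⟨s, hs, hs'⟩ := h.exists_update_peak (Ne.symm hi.1) hc hax hxb Q
      refine ⟨Function.update Q j s, fun k hk => ?_, hs'.trans hD⟩
      by_cases hkj : k = j
      · subst hkj
        rwa [Function.update_self]
      · rw [Function.update_of_ne hkj]
        exact hQ k ((Finset.mem_insert.1 hk).resolve_left hkj)
  obtain ⟨Q, hQ, hD⟩ := key (Finset.univ.erase i) (by simp)
  have hpt : ∀ t : SPDomain m, t.1.peak = x → (φ (Function.update Q i t)).1 a = 0 := by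
    intro t ht
    refine eq_zero_of_ne (hu x _ fun k => ?_) hax.ne
    by_cases hk : k = i
    · subst hk
      rwa [Function.update_self]
    · rw [Function.update_of_ne hk]
      exact hQ k (by simp [hk])
  rw [hpt r hr, hpt r' hr', sub_self] at hD
  have hall : ∀ c, c ≠ b →
      (φ (Function.update P i r)).1 c = (φ (Function.update P i r')).1 c := by
    intro c hcb
    by_cases hca : c = a
    · subst hca
      linarith
    · exact hc P c hca hcb
  have hsub : ∀ U : Set (Fin m), b ∉ U →
      prob (φ (Function.update P i r)) U = prob (φ (Function.update P i r')) U := by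
    intro U hbU
    refine Finset.sum_congr rfl fun c _ => ?_
    by_cases hcU : c ∈ U
    · rw [Set.indicator_of_mem hcU, Set.indicator_of_mem hcU, hall c]
      rintro rfl
      exact hbU hcU
    · simp [hcU]
  by_cases hbL : b ∈ L
  · have h1 := hsub Lᶜ (by simpa using hbL)
    linarith [prob_add_compl (φ (Function.update P i r)) L,
      prob_add_compl (φ (Function.update P i r')) L]
  · exact hsub L hbL

/-! ### Exchanging two neighbouring projects -/

/-- Move `a` above `b`, where `b` is ranked immediately above `a`. -/
def Pref.raise {m : ℕ} (r : Pref m) (a b : Fin m) (hab : a ≠ b) (hba : r.rel b a)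
    (hadj : ∀ c, r.rel b c → r.rel c a → c = b ∨ c = a) : Pref m where
  rel p p' := (p = a ∧ p' = b) ∨ (r.rel p p' ∧ ¬(p = b ∧ p' = a))
  complete p p' := by
    have := r.complete p p'
    by_cases h1 : p = a <;> by_cases h2 : p' = b <;> by_cases h3 : p = b <;>
      by_cases h4 : p' = a <;> simp_all
  refl p := Or.inr ⟨r.refl p, fun h => hab (h.2.symm.trans h.1)⟩
  antisymm p p' := by
    rintro (⟨rfl, rfl⟩ | ⟨h1, h2⟩) (⟨h3, h4⟩ | ⟨h3, h4⟩)
    · exact h4.trans rfl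
    · exact absurd ⟨rfl, rfl⟩ h4
    · exact absurd ⟨h4, h3⟩ h2
    · exact r.antisymm _ _ h1 h3
  trans p p' p'' := by
    rintro (⟨rfl, rfl⟩ | ⟨h1, h2⟩) (⟨h3, h4⟩ | ⟨h3, h4⟩)
    · exact absurd h3.symm hab
    · by_cases h5 : p'' = p'
      · exact Or.inl ⟨rfl, h5⟩
      · refine Or.inr ⟨?_, fun h => hab h.1⟩
        rcases r.complete p p'' with h | h
        · exact h
        · rcases hadj _ h3 h with rfl | rfl
          · exact absurd rfl h5
          · exact r.refl _
    · subst h3 h4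
      by_cases h5 : p = p'
      · exact Or.inl ⟨h5, rfl⟩
      · refine Or.inr ⟨?_, fun h => hab h.2.symm⟩
        rcases r.complete p p'' with h | h
        · exact h
        · rcases hadj _ h h1 with rfl | rfl
          · exact r.refl _
          · exact absurd rfl h5
    · by_cases h5 : p = b ∧ p'' = a
      · obtain ⟨rfl, rfl⟩ := h5
        rcases hadj _ h1 h3 with rfl | rfl
        · exact absurd ⟨rfl, rfl⟩ h4
        · exact absurd ⟨rfl, rfl⟩ h2
      · exact Or.inr ⟨r.trans _ _ _ h1 h3, h5⟩

theorem Pref.IsUpper.raise {m : ℕ} {r : Pref m} {a b : Fin m} {hab : a ≠ b} {hba : r.rel b a}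
    {hadj : ∀ c, r.rel b c → r.rel c a → c = b ∨ c = a} {U : Set (Fin m)} (hU : r.IsUpper U)
    (h : b ∈ U → a ∈ U) : (r.raise a b hab hba hadj).IsUpper U := by
  rintro p p' hp (⟨rfl, rfl⟩ | ⟨h1, -⟩)
  exacts [h hp, hU _ _ hp h1]

/-- If some project outside `L` is better than some project in `L`, then two such projects are
neighbours. -/
theorem Pref.exists_adjacent {m : ℕ} {r : Pref m} {L : Set (Fin m)} (hL : ¬ r.IsUpper L) :
    ∃ a b, a ∈ L ∧ b ∉ L ∧ r.rel b a ∧ ∀ c, r.rel b c → r.rel c a → c = b ∨ c = a := by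
  obtain ⟨f, hf⟩ := r.exists_cost
  let T : Set (Fin m × Fin m) := {x | x.1 ∈ L ∧ x.2 ∉ L ∧ r.rel x.2 x.1}
  have hT : T.Nonempty := by
    by_contra hT
    refine hL fun p p' hp h => ?_
    by_contra hp'
    exact hT ⟨(p, p'), hp, hp', h⟩
  -- Take a pair with least cost gap: a project strictly in between would form a closer pair with
  -- `a` or with `b`.
  obtain ⟨⟨a, b⟩, ⟨ha, hb, hba⟩, hmin⟩ :=
    Set.exists_min_image T (fun x => f x.1 - f x.2) T.toFinite hT
  refine ⟨a, b, ha, hb, hba, fun c hbc hca => ?_⟩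
  by_contra! hne
  have h1 : ¬ f c ≤ f b := fun h => hne.1 (r.antisymm _ _ ((hf _ _).2 h) hbc)
  have h2 : ¬ f a ≤ f c := fun h => hne.2 (r.antisymm _ _ hca ((hf _ _).2 h))
  by_cases hc : c ∈ L
  · have := hmin (c, b) ⟨hc, hb, hbc⟩
    simp only at this
    omega
  · have := hmin (a, c) ⟨ha, hc, hca⟩
    simp only at this
    omega

/-- The probability of `c` is the difference of those of two sets that are upper for both
preferences. -/
theorem IsStrategyProof.apply_eq_of_upper {n m : ℕ} [NeZero m] {φ : RSCR n m}
    (h : IsStrategyProof φ) {i : Fin n} {r r' : SPDomain m} (c : Fin m)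
    (h1 : r'.1.IsUpper (r.1.upperContour c))
    (h2 : r'.1.IsUpper (r.1.upperContour c \ {c})) (P : Profile n m) :
    (φ (Function.update P i r)).1 c = (φ (Function.update P i r')).1 c := by
  have hc : insert c (r.1.upperContour c \ {c}) = r.1.upperContour c :=
    Set.insert_sdiff_self_of_mem (r.1.refl c)
  have hup : r.1.IsUpper (r.1.upperContour c \ {c}) := by
    intro p p' hp hpp
    refine ⟨r.1.trans _ _ _ hpp hp.1, ?_⟩
    rintro rfl
    exact hp.2 (r.1.antisymm _ _ hp.1 hpp)
  have e1 := h.prob_eq (i := i) (P := P) (r.1.isUpper_upperContour c) h1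
  have e2 := h.prob_eq (i := i) (P := P) hup h2
  rw [← hc, prob_insert _ (by simp), prob_insert _ (by simp)] at e1
  linarith

/-- The probability of an interval containing the peak of a voter does not change when this voter
ranks the whole interval above the remaining projects. -/
theorem IsStrategyProof.prob_eq_of_peak_mem {n m : ℕ} [NeZero m] {φ : RSCR n m}
    (h : IsStrategyProof φ) (hu : IsUnanimous φ) {i : Fin n} (P : Profile n m) {L : Set (Fin m)}
    (hL : L.OrdConnected) {e : SPDomain m} (he : e.1.IsUpper L) (r : SPDomain m)
    (hr : r.1.peak ∈ L) :
    prob (φ (Function.update P i r)) L = prob (φ (Function.update P i e)) L := by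
  classical
  let inv : SPDomain m → Finset (Fin m × Fin m) := fun r =>
    Finset.univ.filter fun x => x.1 ∈ L ∧ x.2 ∉ L ∧ r.1.rel x.2 x.1
  induction hN : (inv r).card using Nat.strong_induction_on generalizing r with
  -- Induction on the number of pairs with a project outside `L` ranked above one inside.
  | _ N ih =>
  subst hN
  by_cases hup : r.1.IsUpper L
  · exact h.prob_eq hup he
  obtain ⟨a, b, ha, hb, hba, hadj⟩ := Pref.exists_adjacent hup
  have hab : a ≠ b := by
    rintro rfl
    exact hb ha
  set x := r.1.peak with hx
  have hxb : x ≠ b := by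
    rintro h
    exact hb (h ▸ hr)
  have hxa : x ≠ a := by
    intro h1
    exact hab (r.1.antisymm _ _ (h1 ▸ r.1.rel_peak b) hba)
  have hnot : ¬ r.1.rel a b := fun h1 => hab (r.1.antisymm _ _ h1 hba)
  -- On one side of the peak, `b` would lie in the interval `L` or be ranked below `a`.
  have hbetween : a < x ∧ x < b ∨ b < x ∧ x < a := by
    rcases lt_or_gt_of_ne hxa with h1 | h1
    · refine Or.inr ⟨?_, h1⟩
      by_contra! h2
      rcases le_total b a with h3 | h3
      · exact hb (hL.out hr ha ⟨h2, h3⟩)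
      · exact hnot (Pref.rel_of_between r.2 (Or.inl ⟨h1.le, h3⟩))
    · refine Or.inl ⟨h1, ?_⟩
      by_contra! h2
      rcases le_total a b with h3 | h3
      · exact hb (hL.out ha hr ⟨h3, h2⟩)
      · exact hnot (Pref.rel_of_between r.2 (Or.inr ⟨h3, h1.le⟩))
  let r₁ : Pref m := r.1.raise a b hab hba hadj
  have hpeak : r₁.peak = x := Pref.peak_eq fun p =>
    Or.inr ⟨r.1.rel_peak p, fun h => hxb h.1⟩
  have hsp : r₁.IsSinglePeaked := by
    intro p p' hpp
    rw [hpeak] at hpp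
    obtain ⟨h1, h2⟩ := r.2 p p' hpp
    refine ⟨Or.inr ⟨h1, ?_⟩, h2⟩
    rintro ⟨rfl, rfl⟩
    omega
  have hc : ∀ P c, c ≠ a → c ≠ b →
      (φ (Function.update P i r)).1 c = (φ (Function.update P i ⟨r₁, hsp⟩)).1 c := by
    intro P c hca hcb
    have hbac : r.1.rel b c → r.1.rel a c := by
      intro h1
      rcases r.1.complete a c with h2 | h2
      · exact h2
      · exact absurd (hadj c h1 h2) (by simp [hca, hcb])
    refine h.apply_eq_of_upper c ((r.1.isUpper_upperContour c).raise (hab := hab) (hba := hba)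
      (hadj := hadj) hbac) ?_ P
    refine Pref.IsUpper.raise (hab := hab) (hba := hba) (hadj := hadj) ?_ fun h1 => ⟨hbac h1.1, hca.symm⟩
    intro p p' hp hpp
    refine ⟨r.1.trans _ _ _ hpp hp.1, ?_⟩
    rintro rfl
    exact hp.2 (r.1.antisymm _ _ hp.1 hpp)
  have hstep : prob (φ (Function.update P i r)) L =
      prob (φ (Function.update P i ⟨r₁, hsp⟩)) L := by
    rcases hbetween with ⟨h1, h2⟩ | ⟨h1, h2⟩
    · exact h.apply_update_eq hu hc hx.symm hpeak h1 h2 P L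
    · exact h.apply_update_eq hu (fun P c h3 h4 => hc P c h4 h3) hx.symm hpeak h1 h2 P L
  rw [hstep]
  refine ih _ (Finset.card_lt_card ?_) ⟨r₁, hsp⟩ (by rwa [hpeak]) rfl
  have hsub : inv ⟨r₁, hsp⟩ ⊆ inv r := by
    intro y hy
    obtain ⟨h1, h2, h3⟩ := (Finset.mem_filter.1 hy).2
    refine Finset.mem_filter.2 ⟨Finset.mem_univ _, h1, h2, ?_⟩
    rcases h3 with ⟨h3, -⟩ | h3
    · exact absurd (h3 ▸ ha) h2
    · exact h3.1
  rw [Finset.ssubset_iff_of_subset hsub]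
  refine ⟨(a, b), Finset.mem_filter.2 ⟨Finset.mem_univ _, ha, hb, hba⟩, fun hy => ?_⟩
  rcases (Finset.mem_filter.1 hy).2.2.2 with h3 | h3
  · exact hab h3.1.symm
  · exact h3.2 ⟨rfl, rfl⟩

/-! ### From strategy-proofness to ballots -/

/-- A voter who ranks `L` on top maximizes its probability, and by `prob_eq_of_peak_mem` so does any
voter with peak in `L`. If the new peak is outside `L`, so is the old one, and the same argument
applies to `Lᶜ`. -/
theorem IsStrategyProof.cdf_update_le {n m : ℕ} [NeZero m] {φ : RSCR n m}
    (h : IsStrategyProof φ) (hu : IsUnanimous φ) {i : Fin n} (P : Profile n m) {t : ℕ}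
    {r r' : SPDomain m} (ht : (r.1.peak : ℕ) < t → (r'.1.peak : ℕ) < t) :
    cdf (φ (Function.update P i r)) t ≤ cdf (φ (Function.update P i r')) t := by
  set L : Set (Fin m) := {p | (p : ℕ) < t} with hLdef
  have hL : L.OrdConnected := ⟨fun _ _ _ hq _ hz => lt_of_le_of_lt (Fin.le_def.1 hz.2) hq⟩
  have hLc : Lᶜ.OrdConnected := ⟨fun _ hp _ _ _ hz hzL => hp (lt_of_le_of_lt (Fin.le_def.1 hz.1) hzL)⟩
  change prob _ L ≤ prob _ L
  by_cases hr' : r'.1.peak ∈ L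
  · obtain ⟨e, -, he, -⟩ := exists_singlePeaked hL hL hr' subset_rfl
    rw [h.prob_eq_of_peak_mem hu P hL he r' hr']
    exact h.prob_le _ _ he
  · have hr : r.1.peak ∈ Lᶜ := fun hr => hr' (ht hr)
    obtain ⟨e, -, he, -⟩ := exists_singlePeaked hLc hLc hr subset_rfl
    have h1 := h.prob_eq_of_peak_mem hu (i := i) P hLc he r hr
    have h2 := h.prob_le (i := i) (P := P) e r' he
    linarith [prob_add_compl (φ (Function.update P i r)) L,
      prob_add_compl (φ (Function.update P i r')) L]

theorem IsStrategyProof.cdf_le {n m : ℕ} [NeZero m] {φ : RSCR n m}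
    (h : IsStrategyProof φ) (hu : IsUnanimous φ) {P Q : Profile n m} {t : ℕ}
    (ht : ∀ i, ((P i).1.peak : ℕ) < t → ((Q i).1.peak : ℕ) < t) :
    cdf (φ P) t ≤ cdf (φ Q) t := by
  classical
  have key : ∀ T : Finset (Fin n), cdf (φ P) t ≤ cdf (φ fun i => if i ∈ T then Q i else P i) t := by
    intro T
    induction T using Finset.induction_on with
    | empty => simp
    | insert j T hj ih =>
      have h1 : (fun i => if i ∈ T then Q i else P i) =
          Function.update (fun i => if i ∈ T then Q i else P i) j (P j) := by
        simp [hj]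
      have h2 : (fun i => if i ∈ insert j T then Q i else P i) =
          Function.update (fun i => if i ∈ T then Q i else P i) j (Q j) := by
        exact Function.eq_update_iff.2 ⟨by simp, fun i hi => by simp [hi]⟩
      rw [h2]
      rw [h1] at ih
      exact ih.trans (h.cdf_update_le hu _ (ht j))
  simpa using key Finset.univ

theorem exists_perm_comp_eq {α β : Type*} [Fintype α] [DecidableEq β] (f f' : α → β)
    (h : ∀ b, (Finset.univ.filter fun a => f a = b).card =
      (Finset.univ.filter fun a => f' a = b).card) : ∃ π : Equiv.Perm α, ∀ a, f' (π a) = f a := by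
  have e : ∀ b, Nonempty ({a // f a = b} ≃ {a // f' a = b}) := fun b =>
    Fintype.card_eq.1 (by rw [Fintype.card_subtype, Fintype.card_subtype, h])
  exact ⟨Equiv.ofFiberEquiv fun b => (e b).some, Equiv.ofFiberEquiv_map _⟩

/-- Two sets of voters with comparable numbers of members in every group are related by a
permutation within the groups. -/
theorem exists_perm_group {n g : ℕ} (grp : Fin n → Fin g) (A B : Finset (Fin n))
    (h : ∀ q, ((group grp q).filter (· ∈ A)).card ≤ ((group grp q).filter (· ∈ B)).card) :
    ∃ π : Equiv.Perm (Fin n), (∀ i, grp (π i) = grp i) ∧ ∀ i, i ∈ A → π i ∈ B := by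
  -- Shrink `B` in each group to as many members as `A` has there; labels by group and membership
  -- then have equally large fibres.
  choose T hT hcard using fun q => Finset.exists_subset_card_eq (h q)
  have hTg : ∀ q, (group grp q).filter (fun i => i ∈ T (grp i)) = T q := by
    intro q
    ext i
    simp only [Finset.mem_filter, group, Finset.mem_univ, true_and]
    constructor
    · rintro ⟨rfl, h⟩
      exact h
    · intro hi
      have := Finset.mem_filter.1 (hT q hi)
      have h1 : grp i = q := by simpa [group] using this.1
      exact ⟨h1, h1 ▸ hi⟩
  obtain ⟨π, hπ⟩ := exists_perm_comp_eq (fun i => (grp i, decide (i ∈ A)))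
    (fun i => (grp i, decide (i ∈ T (grp i)))) (by
      rintro ⟨q, v⟩
      have h1 : ((group grp q).filter fun i => i ∈ A).card =
          ((group grp q).filter fun i => i ∈ T (grp i)).card := by rw [hTg, hcard]
      have h2 := Finset.card_filter_add_card_filter_not (s := group grp q) (fun i => i ∈ A)
      have h3 := Finset.card_filter_add_card_filter_not (s := group grp q)
        (fun i => i ∈ T (grp i))
      simp only [group, Finset.filter_filter] at h1 h2 h3
      cases v
      · simp only [Prod.mk.injEq, decide_eq_false_iff_not]
        omega
      · simpa only [Prod.mk.injEq, decide_eq_true_eq] using h1)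
  refine ⟨π, fun i => congrArg Prod.fst (hπ i), fun i hi => ?_⟩
  have h1 := congrArg Prod.snd (hπ i)
  simp only [hi, decide_true, decide_eq_true_eq] at h1
  exact (Finset.mem_filter.1 (hT _ h1)).2

theorem IsStrategyProof.cdf_le_of_alpha_le {n m g : ℕ} [NeZero m] {grp : Fin n → Fin g}
    {φ : RSCR n m} (h : IsStrategyProof φ) (hu : IsUnanimous φ)
    (ha : IsGroupwiseAnonymous grp φ) {P Q : Profile n m} {t : ℕ}
    (ht : alpha grp t P ≤ alpha grp t Q) : cdf (φ P) t ≤ cdf (φ Q) t := by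
  obtain ⟨π, hπ, hπ'⟩ := exists_perm_group grp
    (Finset.univ.filter fun i => ((P i).1.peak : ℕ) < t)
    (Finset.univ.filter fun i => ((Q i).1.peak : ℕ) < t) (fun q => by
      have := Fin.le_def.1 (ht q)
      rw [alpha_val, alpha_val] at this
      simpa using this)
  rw [← ha π hπ Q]
  exact h.cdf_le hu fun i hi => by simpa using hπ' i (by simpa using hi)

/-- With extreme peaks only, the thresholds `1 ≤ t < m` all count exactly the voters at `⊥`. -/
theorem exists_profile {n m g : ℕ} [NeZero m] (grp : Fin n → Fin g) (γ : Gam grp) :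
    ∃ P : Profile n m, (∀ i, (P i).1.peak = ⊥ ∨ (P i).1.peak = ⊤) ∧
      ∀ t, 1 ≤ t → t < m → alpha grp t P = γ := by
  classical
  have hx : ∀ x : Fin m, ∃ r : SPDomain m, r.1.peak = x := fun x => by
    obtain ⟨r, hr, -⟩ := exists_singlePeaked (x := x) Set.ordConnected_univ
      Set.ordConnected_univ (Set.mem_univ _) subset_rfl
    exact ⟨r, hr⟩
  obtain ⟨rb, hrb⟩ := hx ⊥
  obtain ⟨rt, hrt⟩ := hx ⊤
  choose T hT hcard using fun q =>
    Finset.exists_subset_card_eq (s := group grp q) (Nat.le_of_lt_succ (γ q).2)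
  refine ⟨fun i => if i ∈ T (grp i) then rb else rt, fun i => ?_, fun t h1 h2 => ?_⟩
  · by_cases hi : i ∈ T (grp i)
    · simp [hi, hrb]
    · simp [hi, hrt]
  · refine funext fun q => Fin.ext ?_
    rw [alpha_val, ← hcard q]
    congr 1
    ext i
    have hbot : ((⊥ : Fin m) : ℕ) < t := by
      have : (⊥ : Fin m) ≤ ⟨0, by omega⟩ := bot_le
      exact lt_of_le_of_lt this h1
    have htop : ¬ ((⊤ : Fin m) : ℕ) < t := by
      have : (⟨t, h2⟩ : Fin m) ≤ ⊤ := le_top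
      exact not_lt.2 this
    simp only [Finset.mem_filter]
    constructor
    · rintro ⟨hq, hi⟩
      have hq' : grp i = q := by simpa [group] using hq
      by_contra hiT
      rw [if_neg (by rwa [hq']), hrt] at hi
      exact htop hi
    · intro hi
      have hq' : grp i = q := by simpa [group] using hT q hi
      refine ⟨hT q hi, ?_⟩
      rwa [if_pos (by rwa [hq']), hrb]

theorem isPFGBR_of_isStrategyProof {n m g : ℕ} [NeZero m] {grp : Fin n → Fin g} {φ : RSCR n m}
    (hu : IsUnanimous φ) (h : IsStrategyProof φ) (ha : IsGroupwiseAnonymous grp φ) :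
    IsPFGBR grp φ := by
  choose Q hQ hQα using exists_profile (m := m) grp
  have hm : 0 < m := Nat.pos_of_ne_zero (NeZero.ne m)
  have hbt : ∀ γ : Gam grp, ∀ x y : Fin m, (∀ i, (Q γ i).1.peak = x ∨ (Q γ i).1.peak = y) →
      (1 < m → ∀ i, (Q γ i).1.peak ≠ y) → (φ (Q γ)).1 x = 1 := by
    intro γ x y h1 h2
    refine hu x _ fun i => ?_
    rcases h1 i with h3 | h3
    · exact h3
    · by_cases hm1 : 1 < m
      · exact absurd h3 (h2 hm1 i)
      · ext
        omega
  refine ⟨fun γ => φ (Q γ), ⟨?_, ?_⟩, ?_, ?_⟩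
  · refine hbt _ ⊤ ⊥ (fun i => (hQ _ i).symm) fun hm1 i hi => ?_
    have h1 := congrArg Fin.val (congrFun (hQα (gamBot grp) 1 le_rfl hm1) (grp i))
    rw [alpha_val] at h1
    simp only [gamBot, Fin.val_zero, Finset.card_eq_zero] at h1
    have hb : ((⊥ : Fin m) : ℕ) < 1 := by
      have : (⊥ : Fin m) ≤ ⟨0, hm⟩ := bot_le
      exact Nat.lt_succ_of_le this
    have : i ∈ (∅ : Finset (Fin n)) := by
      rw [← h1, Finset.mem_filter, hi]
      exact ⟨by simp [group], hb⟩
    simp at this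
  · refine hbt _ ⊥ ⊤ (hQ _) fun hm1 i hi => ?_
    have h1 := congrArg Fin.val (congrFun (hQα (gamTop grp) 1 le_rfl hm1) (grp i))
    rw [alpha_val] at h1
    simp only [gamTop, Fin.val_last, Finset.card_filter_eq_iff] at h1
    have h2 := h1 i (by simp [group])
    rw [hi] at h2
    have : (⟨1, hm1⟩ : Fin m) ≤ ⊤ := le_top
    exact absurd h2 (not_lt.2 this)
  · intro γ γ' hγ t ht1 htm
    rcases htm.lt_or_eq with hlt | rfl
    · refine h.cdf_le_of_alpha_le hu ha ?_
      rwa [hQα _ t ht1 hlt, hQα _ t ht1 hlt]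
    · rw [cdf_of_le _ le_rfl, cdf_of_le _ le_rfl]
  · intro P k
    -- At `t = 0` and `t = m` the chosen profile need not have the same `α`, but there the values
    -- are `0` and `1` anyway.
    have key : ∀ t ≤ m, cdf (φ P) t = cdf (φ (Q (alpha grp t P))) t := by
      intro t htm
      rcases Nat.eq_zero_or_pos t with rfl | ht1
      · rw [cdf_zero, cdf_zero]
      rcases htm.lt_or_eq with hlt | rfl
      · have h1 := hQα (alpha grp t P) t ht1 hlt
        exact le_antisymm (h.cdf_le_of_alpha_le hu ha h1.ge) (h.cdf_le_of_alpha_le hu ha h1.le)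
      · rw [cdf_of_le _ le_rfl, cdf_of_le _ le_rfl]
    rw [← key _ k.2, ← key _ k.2.le, cdf_succ]
    ring

end GroupFair

theorem mainTheorem3 (n m g : ℕ) [NeZero m] (hn : 2 ≤ n) (grp : Fin n → Fin g) :
    (∀ φ : GroupFair.RSCR n m,
      GroupFair.IsPFGBR grp φ → GroupFair.IsRandomGMMR grp φ) ∧
    (∀ φ : GroupFair.RSCR n m,
      (GroupFair.IsUnanimous φ ∧ GroupFair.IsStrategyProof φ ∧
        GroupFair.IsGroupwiseAnonymous grp φ) ↔ GroupFair.IsRandomGMMR grp φ) := by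
  refine ⟨fun φ h => h.isRandomGMMR, fun φ => ⟨fun h => ?_, fun h => ?_⟩⟩
  · exact (GroupFair.isPFGBR_of_isStrategyProof h.1 h.2.1 h.2.2).isRandomGMMR
  · exact ⟨h.isUnanimous, h.isStrategyProof, h.isGroupwiseAnonymous⟩
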